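/- Conventions. Let $\mathcal L$ be a first-order language and $\mathcal M$ an $\mathcal L$-structure with underlying set $M$. Formulas are $\mathcal L$-formulas without parameters, and $x$, $y$, $z$, $x_i$, $y_i$ denote finite tuples of variables, with $|x|$ the length of $x$. For a formula $\varphi(x;y)$ and $b\in M^{|y|}$ put $\varphi(M;b)=\{a\in M^{|x|} : \mathcal M\models\varphi(a;b)\}$. A set $A\subseteq M^{|x|}$ crosses $X\subseteq M^{|x|}$ if both $X\cap A$ and $X\setminus A$ are nonempty. The structure $\mathcal M$ is *distal* if every formula $\varphi(x;y)$ admits a distal cell decomposition, that is, there are $k\in\mathbb N$, a finite set $\Psi$ of formulas $\psi(x;y_1,\dots,y_k)$ with $|y_1|=\dots=|y_k|=|y|$, a formula $\theta_\psi(y;y_1,\dots,y_k)$ for each $\psi\in\Psi$, and a map $\mathcal I$ from subsets of $M^{|x|}$ to subsets of $M^{|y|}$ with $\mathcal I(\psi(M;s_1,\dots,s_k))=\theta_\psi(M;s_1,\dots,s_k)$ for all $\psi\in\Psi$ and $s_1,\dots,s_k\in M^{|y|}$, such that for every finite nonempty $S\subseteq M^{|y|}$ the family $$\mathcal T(S)=\{\Delta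 : \Delta=\psi(M;s_1,\dots,s_k)\text{ for some }\psi\in\Psi,\ s_1,\dots,s_k\in S,\text{ and } \mathcal I(\Delta)\cap S=\emptyset\}$$ covers $M^{|x|}$, and no $\Delta\in\mathcal T(S)$ is crossed by a set $\varphi(M;s)$ with $s\in S$. The structure $\mathcal M$ *eliminates $\exists^\infty$* if for every formula $\varphi(x;y)$ there is $n_\varphi\in\mathbb N$ such that for every $b\in M^{|y|}$ the set $\varphi(M;b)$ is infinite if and only if $|\varphi(M;b)|\ge n_\varphi$. Theorem. Let $\mathcal M$ be a distal $\mathcal L$-structure that eliminates $\exists^\infty$. Then for every formula $\varphi(x_1,\dots,x_k;z)$ there are $N\in\mathbb N$ and formulas $\psi_i(x_i;y_i)$, $1\le i\le k$, such that for every $c\in M^{|z|}$, with $R=\{(a_1,\dots,a_k)\in M^{|x_1|}\times\dots\times M^{|x_k|} : \mathcal M\models\varphi(a_1,\dots,a_k;c)\}$, the following are equivalent: 1. There are sets $A_i\subseteq M^{|x_i|}$, $1\le i\le k$, with $|A_1|=\dots=|A_k|=N$ and $A_1\times\dots\times A_k\subseteq R$. 2. There are $b_i\in M^{|y_i|}$,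 $1\le i\le k$, such that every $\psi_i(M;b_i)$ is infinite and $\psi_1(M;b_1)\times\dots\times\psi_k(M;b_k)\subseteq R$. -/

import Mathlib

open FirstOrder

universe u v w

namespace FirstOrder.Language

variable {L : Language.{u, v}} {M : Type w} [L.Structure M] {α β γ : Type}

/-- The set `φ(M; b) = {a : M ⊨ φ(a; b)}` for a formula `φ(x; y)` whose free variables are split
into the tuple `x` (indexed by `α`) and the tuple `y` (indexed by `β`). -/
def solutionSet (φ : L.Formula (α ⊕ β)) (b : β → M) : Set (α → M) :=
  {a | φ.Realize (Sum.elim a b)}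

/-- `A` crosses `X`: both `X ∩ A` and `X ∩ ¬A` are nonempty. -/
def Crosses {V : Type*} (A X : Set V) : Prop :=
  (X ∩ A).Nonempty ∧ (X ∩ Aᶜ).Nonempty

/-- `Φ(x; S)` crosses `X`: some set `φ(M; s)` with `φ ∈ Φ` and `s ∈ S` crosses `X`. -/
def FamilyCrosses (Φ : Set (L.Formula (α ⊕ β))) (S : Set (β → M)) (X : Set (α → M)) : Prop :=
  ∃ φ ∈ Φ, ∃ s ∈ S, Crosses (solutionSet φ s) X

/-- `F` is an abstract cell decomposition for `Φ(x; S)`: the sets in `F` cover the space, and none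
of them is crossed by `Φ(x; S)`. -/
structure IsAbstractCellDecomposition (Φ : Set (L.Formula (α ⊕ β))) (S : Set (β → M))
    (F : Set (Set (α → M))) : Prop where
  sUnion_eq : ⋃₀ F = Set.univ
  not_crossed : ∀ Δ ∈ F, ¬ FamilyCrosses Φ S Δ

/-- The family `Ψ(S)` of all sets `ψ(M; s₁, …, s_k)` with `ψ ∈ Ψ` and `s₁, …, s_k ∈ S`, where `Ψ`
consists of formulas `ψ(x; y₁, …, y_k)` and every `y_j` is a tuple indexed by `β`. -/
def definableOver {k : ℕ} (Ψ : Set (L.Formula (α ⊕ (Fin k × β)))) (S : Set (β → M)) :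
    Set (Set (α → M)) :=
  {Δ | ∃ ψ ∈ Ψ, ∃ s : Fin k → β → M, (∀ j, s j ∈ S) ∧
    Δ = solutionSet ψ (fun p : Fin k × β => s p.1 p.2)}

/-- The assignment `T` is a definable (that is, a distal) cell decomposition for `Φ(x; y)`.
To each finite nonempty set `S` of parameters it assigns an abstract cell decomposition `T S` for
`Φ(x; S)`, and `T S = {Δ ∈ Ψ(S) : I Δ ∩ S = ∅}` for a finite set `Ψ` of formulas
`ψ(x; y₁, …, y_k)` and a map `I` that is uniformly definable:
`I (ψ(M; s₁, …, s_k)) = θ_ψ(M; s₁, …, s_k)`.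

The set `S = ∅` is left out: for `k ≥ 1` there are no `s₁, …, s_k ∈ ∅`, so `Ψ(∅)` is empty and
cannot cover the space. -/
def IsDistalCellDecomposition (Φ : Set (L.Formula (α ⊕ β)))
    (T : Set (β → M) → Set (Set (α → M))) : Prop :=
  (∀ S : Set (β → M), S.Finite → S.Nonempty → IsAbstractCellDecomposition Φ S (T S)) ∧
  ∃ (k : ℕ) (Ψ : Set (L.Formula (α ⊕ (Fin k × β))))
    (I : Set (α → M) → Set (β → M))
    (θ : L.Formula (α ⊕ (Fin k × β)) → L.Formula (β ⊕ (Fin k × β))),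
    Ψ.Finite ∧
    (∀ ψ ∈ Ψ, ∀ s : Fin k × β → M, I (solutionSet ψ s) = solutionSet (θ ψ) s) ∧
    ∀ S : Set (β → M), S.Finite → S.Nonempty →
      T S = {Δ | Δ ∈ definableOver Ψ S ∧ I Δ ∩ S = ∅}

variable (L M)

/-- The `L`-structure `M` is distal: every formula `φ(x; y)` admits a distal cell
decomposition. -/
def IsDistal : Prop :=
  ∀ (m n : ℕ) (φ : L.Formula (Fin m ⊕ Fin n)),
    ∃ T : Set (Fin n → M) → Set (Set (Fin m → M)),
      IsDistalCellDecomposition ({φ} : Set (L.Formula (Fin m ⊕ Fin n))) T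

/-- The `L`-structure `M` eliminates the quantifier `∃^∞`: for every formula `φ(x; y)` there is
`r` such that a set `φ(M; b)` is infinite if and only if it has at least `r` elements. -/
def EliminatesExistsInfinity : Prop :=
  ∀ (m n : ℕ) (φ : L.Formula (Fin m ⊕ Fin n)),
    ∃ r : ℕ, ∀ b : Fin n → M,
      (solutionSet φ b).Infinite ↔ (r : ℕ∞) ≤ (solutionSet φ b).encard

end FirstOrder.Language

/-!
Only the covering half of distality is used: over a finite set `S` of parameters the space is
covered by at most `C(|S|)` definable cells, none of them crossed by a set `φ(M; s)` with `s ∈ S`,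
where `C` depends on `φ` alone.

Let `A₁ × ⋯ × A_k ⊆ R`. Shrink `A₂, …, A_k` to a fixed size `n` and regard `φ` as a formula in the
variable `x₁` whose parameters are the remaining variables, so that `S = A₂ × ⋯ × A_k × {c}`. If
`A₁` is large compared with `C(n ^ (k - 1))`, then by the pigeonhole principle some cell `Δ` contains
many points of `A₁`. Elimination of `∃^∞` makes `Δ` infinite, and since `Δ` meets `A₁` and is not
crossed, `Δ × A₂ × ⋯ × A_k ⊆ R`. The condition `Δ × {(x₂, …, x_k)} ⊆ R` on `(x₂, …, x_k)` is a
formula whose parameters are `c` and those of `Δ`, so induction on `k`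
(`exists_infinite_definable_boxes`) applies to it.

The cells come from finitely many formulas; they are merged into a single one
(`exists_formula_merging`) by means of extra parameters that encode, through equalities, which of
the formulas is meant. This needs two elements in `M`. If `M` has at most one element, every power
of `M` is finite with at most one element, and `N = 2` works.
-/

namespace FirstOrder.Language

section

variable {L : Language.{u, v}} {M : Type w} [L.Structure M]

/-- In a structure with two elements, finitely many formulas `ψ(x; y)` can be merged into a single
formula: every set defined by some `ψ` is defined by the merged one, with suitable parameters. -/
theorem exists_formula_merging [Nontrivial M] {α δ : Type} [Finite δ]
    {Ψ : Set (L.Formula (α ⊕ δ))} (hΨ : Ψ.Finite) :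
    ∃ (g : ℕ) (χ : L.Formula (α ⊕ Fin g)) (p : L.Formula (α ⊕ δ) → (δ → M) → Fin g → M),
      ∀ ψ ∈ Ψ, ∀ s, solutionSet χ (p ψ s) = solutionSet ψ s := by
  classical
  obtain ⟨a, b, hab⟩ := exists_pair_ne M
  have := hΨ.to_subtype
  obtain ⟨j, ⟨e⟩⟩ := Finite.exists_equiv_fin Ψ
  -- The variables `w none` and `w i` select the formula number `i` by the condition `w none = w i`.
  obtain ⟨g, ⟨f⟩⟩ := Finite.exists_equiv_fin (δ ⊕ Option (Fin j))
  let w : Option (Fin j) → L.Term (α ⊕ Fin g) := fun o => Term.var (Sum.inr (f (Sum.inr o)))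
  let χ : L.Formula (α ⊕ Fin g) := Formula.iSup fun i : Fin j =>
    (w none).equal (w (some i)) ⊓ (e.symm i).1.relabel (Sum.map id (f ∘ Sum.inl))
  let p : L.Formula (α ⊕ δ) → (δ → M) → Fin g → M := fun ψ s =>
    (Sum.elim s fun o => o.elim a fun i => if (e.symm i).1 = ψ then a else b) ∘ f.symm
  refine ⟨g, χ, p, fun ψ hψ s => ?_⟩
  ext x
  have hs : (Sum.elim x (p ψ s)) ∘ Sum.map id (f ∘ Sum.inl) = Sum.elim x s := by
    ext (i | i) <;> simp [p]
  have hw : ∀ i, p ψ s (f (Sum.inr none)) = p ψ s (f (Sum.inr (some i))) ↔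
      (e.symm i).1 = ψ := fun i => by
    by_cases h : (e.symm i).1 = ψ <;> simp [p, h, hab]
  simp only [solutionSet, Set.mem_ofPred_eq, χ, Formula.realize_iSup, Formula.realize_inf,
    Formula.realize_equal, Formula.realize_relabel, hs]
  simp only [w, Term.realize_var, Sum.elim_inr, hw]
  constructor
  · rintro ⟨i, rfl, h⟩
    exact h
  · exact fun h => ⟨e ⟨ψ, hψ⟩, by simp, by simpa using h⟩

/-- The consequence of distality on which everything rests: for each formula `φ(x; y)` there is one
formula `χ(x; z)` such that over every finite nonempty parameter set `S` the space is covered by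
boundedly many sets `χ(M; p)` that are not crossed by `φ(x; S)`, the bound depending on `|S|`
only. -/
theorem IsDistal.exists_uniform_cells [Nontrivial M] (hdistal : IsDistal L M) {m : ℕ} {β : Type}
    [Finite β] (φ : L.Formula (Fin m ⊕ β)) :
    ∃ (g : ℕ) (χ : L.Formula (Fin m ⊕ Fin g)) (C : ℕ → ℕ), ∀ S : Finset (β → M), S.Nonempty →
      ∃ P : Finset (Fin g → M), P.card ≤ C S.card ∧ ∀ a, ∃ p ∈ P, a ∈ solutionSet χ p ∧
        ∀ s ∈ S, ¬ Crosses (solutionSet φ s) (solutionSet χ p) := by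
  classical
  obtain ⟨n, ⟨e⟩⟩ := Finite.exists_equiv_fin β
  obtain ⟨T, hT, k, Ψ, I, θ, hΨ, -, hTΨ⟩ := hdistal m n (φ.relabel (Sum.map id e))
  have hφ : ∀ s : β → M,
      solutionSet (φ.relabel (Sum.map id e)) (s ∘ e.symm) = solutionSet φ s := fun s => by
    ext x
    simp only [solutionSet, Set.mem_ofPred_eq, Formula.realize_relabel]
    rw [show Sum.elim x (s ∘ e.symm) ∘ Sum.map id e = Sum.elim x s by ext (i | i) <;> simp]
  obtain ⟨g, χ, p, hp⟩ := exists_formula_merging (M := M) hΨ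
  refine ⟨g, χ, fun N => hΨ.toFinset.card * N ^ k, fun S hS => ?_⟩
  let S' : Finset (Fin n → M) := S.image (· ∘ e.symm)
  have hS' : S'.Nonempty := hS.image _
  have hcover := hT S' S'.finite_toSet (by simpa using hS')
  rw [hTΨ S' S'.finite_toSet (by simpa using hS')] at hcover
  refine ⟨(hΨ.toFinset ×ˢ Fintype.piFinset fun _ : Fin k => S').image
    fun q => p q.1 fun i => q.2 i.1 i.2, ?_, fun a => ?_⟩
  · refine Finset.card_image_le.trans ?_
    rw [Finset.card_product, Fintype.card_piFinset_const]
    exact Nat.mul_le_mul_left _ (Nat.pow_le_pow_left Finset.card_image_le k)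
  · obtain ⟨Δ, hΔ, ha⟩ := Set.mem_sUnion.1 (hcover.sUnion_eq ▸ Set.mem_univ a)
    have hcross := hcover.not_crossed Δ hΔ
    obtain ⟨⟨ψ, hψ, s, hs, rfl⟩, -⟩ := hΔ
    have hmem : (ψ, s) ∈ hΨ.toFinset ×ˢ Fintype.piFinset fun _ : Fin k => S' :=
      Finset.mem_product.2 ⟨hΨ.mem_toFinset.2 hψ, Fintype.mem_piFinset.2 hs⟩
    refine ⟨_, Finset.mem_image_of_mem _ hmem, ?_⟩
    simp only [hp ψ hψ]
    refine ⟨ha, fun t ht h => hcross ⟨_, rfl, t ∘ e.symm, ?_, by rwa [hφ]⟩⟩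
    exact Finset.mem_coe.2 (Finset.mem_image_of_mem _ ht)

/-- A large finite product set inside a relation `φ(x₁, …, x_k; c)` yields a product of infinite
sets inside it, each taken from a family `Θ i` of uniformly definable sets that does not depend on
`c`. The parameters `c` are indexed by an arbitrary finite type, as the induction on `k` adds the
parameters of a cell to them. -/
theorem exists_infinite_definable_boxes [Nontrivial M] (hdistal : IsDistal L M)
    (helim : EliminatesExistsInfinity L M) (k : ℕ) (d : Fin k → ℕ) (β : Type) [Finite β]
    (φ : L.Formula ((Σ i : Fin k, Fin (d i)) ⊕ β)) :
    ∃ (N : ℕ) (Θ : ∀ i, Σ e : ℕ, L.Formula (Fin (d i) ⊕ Fin e)), ∀ (c : β → M)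
      (A : ∀ i, Finset (Fin (d i) → M)), (∀ i, N ≤ (A i).card) →
      (∀ a : ∀ i, Fin (d i) → M, (∀ i, a i ∈ A i) →
        φ.Realize (Sum.elim (fun q => a q.1 q.2) c)) →
      ∃ b : ∀ i, Fin (Θ i).1 → M, (∀ i, (solutionSet (Θ i).2 (b i)).Infinite) ∧
        ∀ a : ∀ i, Fin (d i) → M, (∀ i, a i ∈ solutionSet (Θ i).2 (b i)) →
          φ.Realize (Sum.elim (fun q => a q.1 q.2) c) := by
  classical
  induction k generalizing β with
  | zero =>
    exact ⟨0, fun i => i.elim0, fun c A _ h => ⟨fun i => i.elim0, fun i => i.elim0,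
      fun a _ => h a fun i => i.elim0⟩⟩
  | succ k ih =>
    -- `φ₁` is `φ` with all variables but `x₁` regarded as parameters.
    let τ : (Σ i : Fin (k + 1), Fin (d i)) ⊕ β →
        Fin (d 0) ⊕ ((Σ i : Fin k, Fin (d i.succ)) ⊕ β) :=
      Sum.elim (fun q => Fin.cases (motive := fun i => Fin (d i) →
          Fin (d 0) ⊕ ((Σ i : Fin k, Fin (d i.succ)) ⊕ β))
        Sum.inl (fun i j => Sum.inr (Sum.inl ⟨i, j⟩)) q.1 q.2) (Sum.inr ∘ Sum.inr)
    let φ₁ := φ.relabel τ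
    have hφ₁ : ∀ (c : β → M) (a : ∀ i, Fin (d i) → M),
        φ₁.Realize (Sum.elim (a 0) (Sum.elim (fun q => a q.1.succ q.2) c)) ↔
          φ.Realize (Sum.elim (fun q => a q.1 q.2) c) := fun c a => by
      rw [Formula.realize_relabel]
      apply iff_of_eq
      congr 1
      ext (⟨i, j⟩ | i)
      · cases i using Fin.cases <;> rfl
      · rfl
    obtain ⟨g, χ, C, hχ⟩ := hdistal.exists_uniform_cells φ₁
    -- `φ₂(x₂, …, x_k; p, c)` says that `χ(M; p) × {(x₂, …, x_k)} ⊆ R`.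
    let φ₂ : L.Formula ((Σ i : Fin k, Fin (d i.succ)) ⊕ (Fin g ⊕ β)) :=
      ((χ.relabel (Sum.elim Sum.inr (Sum.inl ∘ Sum.inr ∘ Sum.inl))).imp
        (φ₁.relabel (Sum.elim Sum.inr
          (Sum.inl ∘ Sum.map id Sum.inr)))).iAlls (Fin (d 0))
    have hφ₂ : ∀ (y : (Σ i : Fin k, Fin (d i.succ)) → M) (p : Fin g → M) (c : β → M),
        φ₂.Realize (Sum.elim y (Sum.elim p c)) ↔
          ∀ x ∈ solutionSet χ p, φ₁.Realize (Sum.elim x (Sum.elim y c)) := fun y p c => by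
      simp only [φ₂, Formula.realize_iAlls, Formula.realize_imp, Formula.realize_relabel,
        solutionSet, Set.mem_ofPred_eq]
      refine forall_congr' fun x => imp_congr (iff_of_eq ?_) (iff_of_eq ?_) <;> congr 1
      · ext (i | i) <;> rfl
      · ext (i | i | i) <;> rfl
    obtain ⟨n, Θ, hΘ⟩ := ih (fun i => d i.succ) (Fin g ⊕ β) φ₂
    obtain ⟨r, hr⟩ := helim (d 0) g χ
    -- Size `n + 1` instead of `n` keeps the parameter set nonempty. The second bound leaves more
    -- than `r` points of `A 0` in some cell: one point more than `r` matters only if `r = 0`, as a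
    -- point is needed for the cell to meet `A 0`.
    refine ⟨max (n + 1) (C ((n + 1) ^ k) * r + 1),
      Fin.cons ⟨g, χ⟩ Θ, fun c A hA hAφ => ?_⟩
    have hsub : ∀ i : Fin k, ∃ B ⊆ A i.succ, B.card = n + 1 := fun i =>
      Finset.exists_subset_card_eq ((le_max_left _ _).trans (hA i.succ))
    choose B hBA hBn using hsub
    -- `S` consists of the parameters `(y, c)` of `φ₁` with `y` in the product of the `B i`.
    let S : Finset (((Σ i : Fin k, Fin (d i.succ)) ⊕ β) → M) :=
      (Fintype.piFinset B).image fun y => Sum.elim (fun q => y q.1 q.2) c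
    have hS : S.Nonempty := by
      refine Finset.Nonempty.image (Fintype.piFinset_nonempty.2 fun i => ?_) _
      exact Finset.card_pos.1 (by rw [hBn]; omega)
    have hScard : S.card = (n + 1) ^ k := by
      rw [Finset.card_image_of_injective, Fintype.card_piFinset]
      · simp [hBn]
      · intro y y' h
        ext i j
        exact congrFun h (Sum.inl ⟨i, j⟩)
    obtain ⟨P, hP, hcover⟩ := hχ S hS
    rw [hScard] at hP
    -- Some uncrossed cell contains more than `r` points of `A 0`.
    obtain ⟨p, hpS, hpr⟩ : ∃ p : Fin g → M,
        (∀ s ∈ S, ¬ Crosses (solutionSet φ₁ s) (solutionSet χ p)) ∧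
          r + 1 ≤ ((A 0).filter (· ∈ solutionSet χ p)).card := by
      choose q hqP hq hqS using hcover
      obtain ⟨p, hpP, hp⟩ := Finset.exists_lt_card_fiber_of_mul_lt_card_of_maps_to
        (s := A 0) (t := P) (n := r) (fun a _ => hqP a) (by
          have h1 := (le_max_right _ _).trans (hA 0)
          have h2 : P.card * r ≤ C ((n + 1) ^ k) * r := Nat.mul_le_mul_right _ hP
          omega)
      obtain ⟨a, ha⟩ := Finset.card_pos.1 (Nat.zero_lt_of_lt hp)
      refine ⟨p, (Finset.mem_filter.1 ha).2 ▸ hqS a, Nat.succ_le_of_lt (hp.trans_le ?_)⟩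
      refine Finset.card_le_card fun x hx => ?_
      obtain ⟨hxA, rfl⟩ := Finset.mem_filter.1 hx
      exact Finset.mem_filter.2 ⟨hxA, hq x⟩
    have hinf : (solutionSet χ p).Infinite := by
      rw [hr]
      calc (r : ℕ∞) ≤ ((A 0).filter (· ∈ solutionSet χ p)).card := by
            exact_mod_cast (Nat.le_succ r).trans hpr
        _ = ((A 0).filter (· ∈ solutionSet χ p) : Set (Fin (d 0) → M)).encard :=
            (Set.encard_coe_eq_coe_finsetCard _).symm
        _ ≤ _ := Set.encard_le_encard fun x hx => (Finset.mem_filter.1 hx).2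
    obtain ⟨a₀, ha₀⟩ := Finset.card_pos.1 (Nat.zero_lt_of_lt hpr)
    obtain ⟨ha₀A, ha₀p⟩ := Finset.mem_filter.1 ha₀
    obtain ⟨b, hb, hbφ⟩ := hΘ (Sum.elim p c) B (fun i => by rw [hBn]; omega) fun y hy => by
      rw [hφ₂]
      by_contra! ⟨x, hxp, hx⟩
      refine hpS _ (Finset.mem_image_of_mem _ (Fintype.mem_piFinset.2 hy))
        ⟨⟨a₀, ha₀p, ?_⟩, ⟨x, hxp, hx⟩⟩
      exact (hφ₁ c (Fin.cons a₀ y)).2 <|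
        hAφ _ (Fin.cases ha₀A fun i => hBA i (hy i))
    refine ⟨Fin.cases p b, Fin.cases hinf hb, fun a ha => ?_⟩
    have h := (hφ₂ _ p c).1 (hbφ (fun i => a i.succ) fun i => ha i.succ)
    exact (hφ₁ c a).1 (h (a 0) (ha 0))

end

end FirstOrder.Language

theorem mainTheorem4 (L : FirstOrder.Language.{u, v}) (M : Type w) [L.Structure M]
    (hdistal : FirstOrder.Language.IsDistal L M)
    (helim : FirstOrder.Language.EliminatesExistsInfinity L M)
    (k : ℕ) (d : Fin k → ℕ) (m : ℕ)
    (φ : L.Formula ((Σ i : Fin k, Fin (d i)) ⊕ Fin m)) :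
    ∃ (N : ℕ) (e : Fin k → ℕ) (ψ : ∀ i : Fin k, L.Formula (Fin (d i) ⊕ Fin (e i))),
      ∀ (c : Fin m → M) (R : Set (∀ i : Fin k, Fin (d i) → M)),
        R = {a | φ.Realize (Sum.elim (fun p : (Σ i : Fin k, Fin (d i)) => a p.1 p.2) c)} →
        ((∃ A : ∀ i : Fin k, Finset (Fin (d i) → M),
            (∀ i, (A i).card = N) ∧
            Set.univ.pi (fun i => (A i : Set (Fin (d i) → M))) ⊆ R) ↔
          ∃ b : ∀ i : Fin k, Fin (e i) → M,
            (∀ i, (FirstOrder.Language.solutionSet (ψ i) (b i)).Infinite) ∧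
            Set.univ.pi (fun i => FirstOrder.Language.solutionSet (ψ i) (b i)) ⊆ R) := by
  rcases Nat.eq_zero_or_pos k with rfl | hk
  · -- The empty product is a single point, so both sides say that this point lies in `R`.
    exact ⟨0, fun i => i.elim0, fun i => i.elim0, fun c R _ =>
      ⟨fun ⟨_, _, h⟩ => ⟨fun i => i.elim0, fun i => i.elim0, fun a _ => h fun i => i.elim0⟩,
        fun ⟨_, _, h⟩ => ⟨fun i => i.elim0, fun i => i.elim0, fun a _ => h fun i => i.elim0⟩⟩⟩
  rcases subsingleton_or_nontrivial M with hM | hM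
  · refine ⟨2, fun _ => 0, fun _ => ⊥, fun c R _ => ⟨?_, ?_⟩⟩
    · rintro ⟨A, hA, -⟩
      have := Finset.card_le_one_of_subsingleton (A ⟨0, hk⟩)
      rw [hA] at this
      omega
    · rintro ⟨b, hb, -⟩
      exact absurd (Set.toFinite _) (hb ⟨0, hk⟩)
  obtain ⟨N, Θ, hΘ⟩ :=
    FirstOrder.Language.exists_infinite_definable_boxes hdistal helim k d (Fin m) φ
  refine ⟨N, fun i => (Θ i).1, fun i => (Θ i).2, ?_⟩
  rintro c R rfl
  constructor
  · rintro ⟨A, hA, hAR⟩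
    obtain ⟨b, hb, hbφ⟩ := hΘ c A (fun i => (hA i).ge) fun a ha => hAR fun i _ => ha i
    exact ⟨b, hb, fun a ha => hbφ a fun i => ha i trivial⟩
  · rintro ⟨b, hb, hbR⟩
    choose A hA hAN using fun i => (hb i).exists_subset_card_eq N
    exact ⟨A, hAN, (Set.pi_mono fun i _ => hA i).trans hbR⟩
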